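/- Let $X$ be a reflexive real Banach space with the metric approximation property, and let $\{Y_i\}_{i\in I}$ be an infinite family of finite-dimensional real Banach spaces. Let $Y$ be a real Banach space whose dual $Y^*$ is linearly isometric to the $\ell^1$-direct sum $\bigoplus_1 Y_i$. Let $\mathcal K(X,Y)$ be the Banach space of compact linear operators from $X$ to $Y$ with the operator norm, and let $Z\subset \mathcal K(X,Y)$ be a closed linear subspace such that every non-zero element $f$ of the annihilator $Z^\perp=\{f\in\mathcal K(X,Y)^* : f(T)=0 \text{ for all } T\in Z\}$ is a point of strong subdifferentiability (SSD point) of $\mathcal K(X,Y)^*$, i.e. the limit $\lim_{t\to 0^+}\frac{\|f+th\|-\|f\|}{t}$ exists uniformly for $h$ in the closed unit ball of $\mathcal K(X,Y)^*$. Then $Z$ is factor reflexive, i.e. the quotient space $\mathcal K(X,Y)/Z$ is reflexive, and $Z$ is proximinal in $\mathcal K(X,Y)$, i.e. for every $T\in\mathcal K(X,Y)$ there is $S\in Z$ with $\|T-S\|=d(T,Z)$. -/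

import Mathlib

open Filter Topology Set
open scoped ENNReal

/-- A real normed space is reflexive if the canonical map into its bidual is onto. -/
def IsReflexiveSpace (E : Type*) [SeminormedAddCommGroup E] [NormedSpace ℝ E] : Prop :=
  Function.Surjective (NormedSpace.inclusionInDoubleDual ℝ E)

/-- The metric approximation property: on every compact set the identity is a uniform limit of
finite rank operators of norm at most one. -/
def HasMetricApproximationProperty (E : Type*) [NormedAddCommGroup E] [NormedSpace ℝ E] : Prop :=
  ∀ C : Set E, IsCompact C → ∀ ε : ℝ, 0 < ε →
    ∃ T : E →L[ℝ] E, FiniteDimensional ℝ (LinearMap.range (T : E →ₗ[ℝ] E)) ∧ ‖T‖ ≤ 1 ∧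
      ∀ x ∈ C, ‖T x - x‖ ≤ ε

/-- The space of compact (linear) operators from `X` to `Y`. -/
def CompactOp (X Y : Type*) [NormedAddCommGroup X] [NormedSpace ℝ X]
    [NormedAddCommGroup Y] [NormedSpace ℝ Y] : Type _ :=
  compactOperator (RingHom.id ℝ) X Y

/-- The operator norm on compact operators, inherited from the bounded operators. -/
noncomputable instance CompactOp.instNormedAddCommGroup (X Y : Type*)
    [NormedAddCommGroup X] [NormedSpace ℝ X] [NormedAddCommGroup Y] [NormedSpace ℝ Y] :
    NormedAddCommGroup (CompactOp X Y) :=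
  inferInstanceAs (NormedAddCommGroup (compactOperator (RingHom.id ℝ) X Y))

/-- The real vector space structure on compact operators, inherited from the bounded operators. -/
noncomputable instance CompactOp.instNormedSpace (X Y : Type*)
    [NormedAddCommGroup X] [NormedSpace ℝ X] [NormedAddCommGroup Y] [NormedSpace ℝ Y] :
    NormedSpace ℝ (CompactOp X Y) :=
  inferInstanceAs (NormedSpace ℝ (compactOperator (RingHom.id ℝ) X Y))

/-- A non-zero vector `x` is a point of strong subdifferentiability if the one-sided limit of
`(‖x + t h‖ - ‖x‖) / t` as `t → 0+` exists uniformly for `h` in the closed unit ball. -/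
def IsSSDPoint {E : Type*} [NormedAddCommGroup E] [NormedSpace ℝ E] (x : E) : Prop :=
  x ≠ 0 ∧ ∃ L : E → ℝ,
    TendstoUniformlyOn (fun (t : ℝ) (h : E) => (‖x + t • h‖ - ‖x‖) / t) L
      (𝓝[>] (0 : ℝ)) (Metric.closedBall (0 : E) 1)

/-- The annihilator of a subspace, in the strong dual. -/
def annihilatorSubspace {E : Type*} [NormedAddCommGroup E] [NormedSpace ℝ E]
    (Z : Submodule ℝ E) : Set (StrongDual ℝ E) :=
  {f | ∀ z ∈ Z, f z = 0}

/-- `Z` is proximinal if every vector has a nearest point in `Z`. -/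
def IsProximinal {E : Type*} [NormedAddCommGroup E] [NormedSpace ℝ E]
    (Z : Submodule ℝ E) : Prop :=
  ∀ y : E, ∃ z ∈ Z, Metric.infDist y (Z : Set E) = ‖y - z‖

/-- `Z` is factor reflexive if the quotient by `Z`, with the quotient norm, is reflexive. -/
def IsFactorReflexive {E : Type*} [NormedAddCommGroup E] [NormedSpace ℝ E]
    (Z : Submodule ℝ E) : Prop :=
  IsReflexiveSpace (E ⧸ Z)

/-! A functional `f` on the compact operators induces `toDualOp f : X* → Y*`. By reflexivity and the
metric approximation property every compact `T` is a norm limit of operators `T ∘ S` with `S` a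
finite rank contraction, so `f` is determined by `toDualOp f`, and `f ∘ compRight S` is nuclear with
almost no loss of norm. Hence a finite rank L-projection of `Y*` lifts to an L-projection of the
dual of the compact operators (`CompactOp.exists_lProjection`).

An SSD point has only finitely many non-zero components under the coordinate L-projections: non-zero
components have norm bounded below, and their norms have bounded sum. By Baire the whole annihilator
of `Z` lives on one finite set `J` of coordinates. With `e` a basis of the corresponding
finite-dimensional part of `Y*`, each annihilating functional is `∑ j, evalDual (x j) (e j)`, and on
such functionals every bidual element is evaluation at a compact operator; this gives reflexivity of
the quotient.

For proximinality, evaluation at `T` on the annihilator extends with norm at most `d(T, Z)` to a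
bidual element, represented by some `T'`. The subspace `leftKer e` is an M-ideal, so the 1½-ball
property corrects `T'` by some `m` in it to norm at most `d(T, Z)`; then `T - T' + m` is a nearest
point. -/

/-! ### Hahn–Banach and dual norm estimates -/

/-- Hahn–Banach for a functional dominated by the norm of a linear map. -/
theorem exists_dual_comp_eq_of_le_norm {U V : Type*} [AddCommGroup U] [Module ℝ U]
    [NormedAddCommGroup V] [NormedSpace ℝ V] (A : U →ₗ[ℝ] V) (φ : U →ₗ[ℝ] ℝ) {C : ℝ}
    (hC : 0 ≤ C) (h : ∀ x, |φ x| ≤ C * ‖A x‖) :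
    ∃ g : StrongDual ℝ V, ‖g‖ ≤ C ∧ ∀ x, g (A x) = φ x := by
  obtain ⟨B, hB⟩ := A.rangeRestrict.exists_rightInverse_of_surjective A.range_rangeRestrict
  have hAB : ∀ v : LinearMap.range A, A (B v) = v := fun v =>
    congrArg Subtype.val (LinearMap.congr_fun hB v)
  -- The bound forces `φ` to vanish on the kernel of `A`, so the choice of preimage is immaterial.
  have hφ : ∀ x, φ (B (A.rangeRestrict x)) = φ x := by
    intro x
    have h1 := h (B (A.rangeRestrict x) - x)
    rw [map_sub, map_sub, hAB] at h1
    rw [show ((A.rangeRestrict x : LinearMap.range A) : V) = A x from rfl, sub_self, norm_zero,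
      mul_zero] at h1
    exact sub_eq_zero.1 (abs_nonpos_iff.1 h1)
  let g₀ : StrongDual ℝ (LinearMap.range A) := (φ ∘ₗ B).mkContinuous C (by
    intro v
    have h1 := h (B v)
    rwa [hAB] at h1)
  obtain ⟨g, hg, hgn⟩ := exists_extension_norm_eq (LinearMap.range A) g₀
  refine ⟨g, hgn ▸ LinearMap.mkContinuous_norm_le _ hC _, fun x => ?_⟩
  rw [← hφ x]
  exact hg (A.rangeRestrict x)

/-- Turns estimates on open balls, as separation theorems give them, into dual norms. -/
theorem mul_norm_le_of_forall_norm_lt {E : Type*} [SeminormedAddCommGroup E] [NormedSpace ℝ E]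
    (f : StrongDual ℝ E) {r c : ℝ} (hr : 0 < r) (h : ∀ a, ‖a‖ < r → f a ≤ c) :
    r * ‖f‖ ≤ c := by
  have hc : 0 ≤ c := by simpa using h 0 (by simpa using hr)
  have habs : ∀ a, ‖a‖ < r → |f a| ≤ c := fun a ha =>
    abs_le.2 ⟨by have := h (-a) (by simpa using ha); simp at this; linarith, h a ha⟩
  have key : ‖f‖ ≤ c / r := by
    refine f.opNorm_le_bound (by positivity) fun x => ?_
    refine le_of_forall_pos_le_add fun ε hε => ?_
    by_cases hx : ‖x‖ = 0
    · refine le_trans ?_ (by rw [hx]; simpa using hε.le : (0:ℝ) ≤ c / r * ‖x‖ + ε)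
      have := f.le_opNorm x
      rwa [hx, mul_zero] at this
    have hx' : 0 < ‖x‖ := lt_of_le_of_ne (norm_nonneg x) (Ne.symm hx)
    by_contra! hcon
    obtain ⟨s, hs0, hs1, hs2⟩ : ∃ s : ℝ, 0 < s ∧ s * ‖x‖ < r ∧ c < s * ‖f x‖ := by
      have hfx : c / r * ‖x‖ < ‖f x‖ := by linarith
      have hf0 : 0 < ‖f x‖ := lt_of_le_of_lt (by positivity) hfx
      have h1 : c / ‖f x‖ < r / ‖x‖ := by
        rw [div_lt_div_iff₀ hf0 hx']
        rw [div_mul_eq_mul_div, div_lt_iff₀ hr] at hfx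
        linarith
      obtain ⟨s, h2, h3⟩ := exists_between h1
      refine ⟨s, lt_of_le_of_lt (by positivity) h2, (lt_div_iff₀ hx').1 h3,
        (div_lt_iff₀ hf0).1 h2⟩
    have := habs (s • x) (by rwa [norm_smul, Real.norm_of_nonneg hs0.le])
    rw [map_smul, smul_eq_mul, abs_mul, abs_of_pos hs0] at this
    rw [Real.norm_eq_abs] at hs2
    linarith
  rw [le_div_iff₀ hr] at key
  linarith

/-- In the sup norm the coordinates range independently over unit balls, so they can be maximised
one at a time. -/
theorem sum_norm_comp_single_le {κ V : Type*} [Fintype κ] [DecidableEq κ]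
    [NormedAddCommGroup V] [NormedSpace ℝ V] (g : StrongDual ℝ (κ → V)) :
    ∑ k, ‖g.comp (ContinuousLinearMap.single ℝ (fun _ : κ => V) k)‖ ≤ ‖g‖ := by
  classical
  set G : κ → StrongDual ℝ V := fun k => g.comp (ContinuousLinearMap.single ℝ (fun _ : κ => V) k)
  have hg : ∀ v : κ → V, g v = ∑ k, G k (v k) := by
    intro v
    conv_lhs => rw [← Finset.univ_sum_single v]
    simp [G, map_sum]
  -- `s` is the set of coordinates already maximised.
  have main : ∀ s : Finset κ, ∀ v : κ → V, (∀ k, ‖v k‖ ≤ 1) →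
      ∑ k ∈ s, ‖G k‖ + ∑ k ∈ sᶜ, G k (v k) ≤ ‖g‖ := by
    intro s
    induction s using Finset.induction_on with
    | empty =>
      intro v hv
      rw [Finset.sum_empty, zero_add, Finset.compl_empty, ← hg]
      refine (le_abs_self _).trans ((g.le_opNorm v).trans ?_)
      exact mul_le_of_le_one_right (norm_nonneg _) ((pi_norm_le_iff_of_nonneg zero_le_one).2 hv)
    | insert k s hk ih =>
      intro v hv
      have hmem : k ∈ sᶜ := by simpa using hk
      have h1 : ∀ a : V, ‖a‖ < 1 →
          G k a ≤ ‖g‖ - ∑ j ∈ s, ‖G j‖ - ∑ j ∈ (insert k s)ᶜ, G j (v j) := by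
        intro a ha
        have h2 := ih (Function.update v k a) (by
          intro j
          by_cases hj : j = k
          · subst hj; simpa using ha.le
          · simpa [hj] using hv j)
        rw [← Finset.add_sum_erase _ _ hmem, Function.update_self] at h2
        have h3 : ∑ j ∈ (sᶜ).erase k, G j (Function.update v k a j)
            = ∑ j ∈ (insert k s)ᶜ, G j (v j) := by
          rw [Finset.compl_insert]
          refine Finset.sum_congr rfl fun j hj => ?_
          rw [Function.update_of_ne (Finset.ne_of_mem_erase hj)]
        rw [h3] at h2
        linarith
      have h4 := mul_norm_le_of_forall_norm_lt (G k) one_pos h1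
      rw [Finset.sum_insert hk]
      linarith
  simpa using main Finset.univ 0 (by simp)

/-- Elements of a closed subspace are detected by the annihilator. -/
theorem mem_of_forall_annihilator {E : Type*} [NormedAddCommGroup E] [NormedSpace ℝ E]
    {Z : Submodule ℝ E} (hZ : IsClosed (Z : Set E)) {x : E}
    (h : ∀ f ∈ annihilatorSubspace Z, f x = 0) : x ∈ Z := by
  by_contra hx
  obtain ⟨f, u, hf, hu⟩ := geometric_hahn_banach_closed_point Z.convex hZ hx
  have hfZ : f ∈ annihilatorSubspace Z := by
    intro z hz
    by_contra hne
    have := hf ((u / f z) • z) (Z.smul_mem _ hz)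
    rw [map_smul, smul_eq_mul, div_mul_cancel₀ _ hne] at this
    exact lt_irrefl _ this
  have h0 := hf 0 Z.zero_mem
  rw [map_zero] at h0
  rw [h f hfZ] at hu
  linarith

/-! ### SSD points and L-projections -/

/-- The norms of the non-zero components of an SSD point under L-projections are bounded below. -/
theorem IsSSDPoint.exists_le_norm_of_lProjection {E : Type*} [NormedAddCommGroup E]
    [NormedSpace ℝ E] {f : E} (hf : IsSSDPoint f) :
    ∃ t₀ > 0, ∀ P : E →ₗ[ℝ] E, (∀ g, ‖P g‖ + ‖g - P g‖ ≤ ‖g‖) → P (P f) = P f → P f ≠ 0 →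
      t₀ ≤ ‖P f‖ := by
  obtain ⟨-, D, hD⟩ := hf
  rw [Metric.tendstoUniformlyOn_iff] at hD
  -- The quotients compared below are `0` and `-1`; both cannot be within `1/2` of one limit.
  have h1 := hD (1 / 2) (by norm_num)
  rw [eventually_nhdsWithin_iff, Metric.eventually_nhds_iff] at h1
  obtain ⟨t₀, ht₀, h2⟩ := h1
  refine ⟨t₀ / 2, by positivity, fun P hP hPP hne => ?_⟩
  by_contra! hlt
  have hs : 0 < ‖P f‖ := norm_pos_iff.2 hne
  set s := ‖P f‖ with hsdef
  have hPeq : ∀ g, ‖g‖ = ‖P g‖ + ‖g - P g‖ := fun g =>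
    le_antisymm (by simpa using norm_add_le (P g) (g - P g)) (hP g)
  -- Along `h` only the component `P f` changes: the norm falls with slope `-1` until `t = s` and is
  -- back to `‖f‖` at `t = 2 * s`, which is below `t₀`.
  set h : E := -(s⁻¹ • P f) with hh
  have hball : h ∈ Metric.closedBall (0 : E) 1 := by
    rw [mem_closedBall_zero_iff, hh, norm_neg, norm_smul, norm_inv, norm_norm,
      inv_mul_cancel₀ hs.ne']
  have hnorm : ∀ t : ℝ, ‖f + t • h‖ = ‖f‖ - s + |1 - t / s| * s := by
    intro t
    have hP1 : P (f + t • h) = (1 - t / s) • P f := by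
      rw [map_add, map_smul, hh, map_neg, map_smul, hPP, sub_smul, one_smul, smul_neg, smul_smul,
        div_eq_mul_inv, sub_eq_add_neg]
    have hP2 : f + t • h - P (f + t • h) = f - P f := by
      rw [hP1, hh, sub_smul, one_smul, smul_neg, smul_smul, div_eq_mul_inv]
      abel
    rw [hPeq (f + t • h), hP2, hP1, norm_smul, Real.norm_eq_abs, hPeq f, ← hsdef]
    ring
  have e1 := h2 (y := 2 * s) (by
    rw [Real.dist_eq, sub_zero, abs_of_pos (by positivity)]; linarith)
    (by simpa using hs) h hball
  have e2 := h2 (y := s / 2) (by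
    rw [Real.dist_eq, sub_zero, abs_of_pos (by positivity)]; linarith)
    (by simpa using hs) h hball
  have q1 : (‖f + (2 * s) • h‖ - ‖f‖) / (2 * s) = 0 := by
    rw [hnorm, mul_div_assoc, div_self hs.ne']
    norm_num
  have q2 : (‖f + (s / 2) • h‖ - ‖f‖) / (s / 2) = -1 := by
    rw [hnorm, div_right_comm, div_self hs.ne', abs_of_pos (by norm_num)]
    field_simp
    ring
  rw [q1, Real.dist_eq, abs_lt] at e1
  rw [q2, Real.dist_eq, abs_lt] at e2
  linarith [e1.1, e1.2, e2.1, e2.2]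

/-! ### M-ideals: the 1½-ball property and best approximation -/

section MIdeal

variable {E : Type*} [NormedAddCommGroup E] [NormedSpace ℝ E]

/-- The 1½-ball property of a subspace whose annihilator is the range of an L-projection. -/
theorem exists_mem_norm_lt_of_lProjection {M : Submodule ℝ E}
    (P : StrongDual ℝ E →ₗ[ℝ] StrongDual ℝ E)
    (hPM : ∀ f, P f ∈ annihilatorSubspace M) (hPid : ∀ f ∈ annihilatorSubspace M, P f = f)
    (hP : ∀ f, ‖P f‖ + ‖f - P f‖ ≤ ‖f‖) {x : E} {d r₁ r₂ : ℝ}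
    (hx : ∀ f ∈ annihilatorSubspace M, f x ≤ d * ‖f‖) (hr₁ : 0 < r₁) (hr₂ : 0 < r₂)
    (hdr : d < r₂) (hxr : ‖x‖ < r₁ + r₂) : ∃ m ∈ M, ‖m‖ < r₁ ∧ ‖x - m‖ < r₂ := by
  by_contra! hcon
  -- If no `m` exists, the product of the two open balls misses the pairs `(m, m - x)`, and the two
  -- convex sets are separated in `E × E`.
  let A : Set (E × E) := (fun m : E => (m, m - x)) '' (M : Set E)
  have hA : Convex ℝ A := by
    have : A = (fun p : E × E => ((0 : E), -x) + p) ''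
        (((LinearMap.prod LinearMap.id LinearMap.id : E →ₗ[ℝ] E × E)) '' (M : Set E)) := by
      ext p
      simp only [A, mem_image, exists_exists_and_eq_and]
      simp [sub_eq_neg_add]
    rw [this]
    exact (M.convex.linear_image _).translate _
  have hdisj : Disjoint (Metric.ball (0 : E) r₁ ×ˢ Metric.ball (0 : E) r₂) A := by
    rw [Set.disjoint_left]
    rintro _ hp ⟨m, hm, rfl⟩
    simp only [mem_prod, mem_ball_zero_iff] at hp
    have := hcon m hm hp.1
    rw [norm_sub_rev] at this
    linarith [hp.2]
  obtain ⟨f, u, hf, hu⟩ := geometric_hahn_banach_open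
    ((convex_ball _ _).prod (convex_ball _ _)) (Metric.isOpen_ball.prod Metric.isOpen_ball)
    hA hdisj
  let f₁ : StrongDual ℝ E := f.comp (ContinuousLinearMap.inl ℝ E E)
  let f₂ : StrongDual ℝ E := f.comp (ContinuousLinearMap.inr ℝ E E)
  have hfs : ∀ a b, f (a, b) = f₁ a + f₂ b := by
    intro a b
    simp only [f₁, f₂, ContinuousLinearMap.comp_apply, ContinuousLinearMap.inl_apply,
      ContinuousLinearMap.inr_apply, ← map_add]
    simp
  have hu0 : 0 < u := by
    have := hf (0, 0) ⟨by simpa using hr₁, by simpa using hr₂⟩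
    rwa [Prod.mk_zero_zero, map_zero] at this
  have hlow : r₁ * ‖f₁‖ + r₂ * ‖f₂‖ ≤ u := by
    have h1 : ∀ b, ‖b‖ < r₂ → f₂ b ≤ u - r₁ * ‖f₁‖ := by
      intro b hb
      have := mul_norm_le_of_forall_norm_lt f₁ (c := u - f₂ b) hr₁ (fun a ha => by
        have := hf (a, b) ⟨by simpa using ha, by simpa using hb⟩
        rw [hfs] at this
        linarith)
      linarith
    have := mul_norm_le_of_forall_norm_lt f₂ hr₂ h1
    linarith
  have hM : ∀ m ∈ M, u ≤ (f₁ + f₂) m - f₂ x := by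
    intro m hm
    have := hu _ ⟨m, hm, rfl⟩
    rw [hfs, map_sub] at this
    rw [add_apply]
    linarith
  have hann : f₁ + f₂ ∈ annihilatorSubspace M := by
    intro m hm
    by_contra hne
    have := hM (((u + f₂ x - 1) / (f₁ + f₂) m) • m) (M.smul_mem _ hm)
    rw [map_smul, smul_eq_mul, div_mul_cancel₀ _ hne] at this
    linarith
  have hux : u ≤ -f₂ x := by simpa using hM 0 M.zero_mem
  -- `P` fixes `f₁ + f₂`, so the complementary components cancel and have equal norms.
  have hsum : f₁ - P f₁ = -(f₂ - P f₂) := by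
    have := hPid _ hann
    rw [map_add] at this
    rw [neg_sub, sub_eq_sub_iff_add_eq_add, add_comm (P f₂), this]
  have n1 := hP f₁
  have n2 := hP f₂
  rw [hsum, norm_neg] at n1
  have b1 : -(P f₂) x ≤ d * ‖P f₂‖ := by
    have := hx (-P f₂) (fun m hm => by
      rw [neg_apply, hPM f₂ m hm, neg_zero])
    rwa [norm_neg, neg_apply] at this
  have b2 : -(f₂ - P f₂) x ≤ ‖f₂ - P f₂‖ * ‖x‖ :=
    (neg_le_abs _).trans ((f₂ - P f₂).le_opNorm x)
  rw [sub_apply] at b2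
  have p1 := norm_nonneg (P f₁)
  have p2 := norm_nonneg (P f₂)
  have p3 := norm_nonneg (f₂ - P f₂)
  -- The lower bound `hlow` for `u` meets the upper bound from `b1` and `b2`. The strict
  -- inequalities `d < r₂` and `‖x‖ < r₁ + r₂` force both parts of `f₂` to vanish, so `u ≤ 0`.
  have k1 : r₁ * (‖P f₁‖ + ‖f₂ - P f₂‖) ≤ r₁ * ‖f₁‖ := by gcongr
  have k2 : r₂ * (‖P f₂‖ + ‖f₂ - P f₂‖) ≤ r₂ * ‖f₂‖ := by gcongr
  have k3 : 0 ≤ r₁ * ‖P f₁‖ := by positivity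
  have k4 : 0 ≤ (r₁ + r₂ - ‖x‖) * ‖f₂ - P f₂‖ := mul_nonneg (by linarith) p3
  have k5 : 0 ≤ (r₂ - d) * ‖P f₂‖ := mul_nonneg (by linarith) p2
  have z1 : ‖f₂ - P f₂‖ = 0 := by
    have : (r₁ + r₂ - ‖x‖) * ‖f₂ - P f₂‖ ≤ 0 := by linarith
    nlinarith
  have z2 : ‖P f₂‖ = 0 := by
    have : (r₂ - d) * ‖P f₂‖ ≤ 0 := by linarith
    nlinarith
  rw [z2] at b1
  rw [z1] at b2
  linarith

/-- Iterating the strict 1½-ball property with geometrically decreasing corrections gives a Cauchy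
sequence in `M`, whose limit attains the bound `d`. -/
theorem exists_mem_norm_sub_le_of_lProjection [CompleteSpace E] {M : Submodule ℝ E}
    (hM : IsClosed (M : Set E)) (P : StrongDual ℝ E →ₗ[ℝ] StrongDual ℝ E)
    (hPM : ∀ f, P f ∈ annihilatorSubspace M) (hPid : ∀ f ∈ annihilatorSubspace M, P f = f)
    (hP : ∀ f, ‖P f‖ + ‖f - P f‖ ≤ ‖f‖) {x : E} {d : ℝ} (hd : 0 ≤ d)
    (hx : ∀ f ∈ annihilatorSubspace M, f x ≤ d * ‖f‖) : ∃ m ∈ M, ‖x - m‖ ≤ d := by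
  have hstep : ∀ (n : ℕ) (m : M), ∃ m' : M, ‖x - m‖ < d + (1 / 2) ^ n →
      ‖x - m'‖ < d + (1 / 2) ^ (n + 1) ∧ dist m m' ≤ 1 / 2 * (1 / 2) ^ n := by
    intro n m
    by_cases hm : ‖x - m‖ < d + (1 / 2) ^ n
    · have hpos : (0 : ℝ) < (1 / 2) ^ (n + 1) := by positivity
      -- The radii add up to `d + (1 / 2) ^ n`, the bound already held by `x - m`.
      obtain ⟨k, hk, hk1, hk2⟩ := exists_mem_norm_lt_of_lProjection P hPM hPid hP
        (x := x - m) (d := d) (r₁ := (1 / 2) ^ (n + 1)) (r₂ := d + (1 / 2) ^ (n + 1))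
        (fun f hf => by rw [map_sub, hf m m.2, sub_zero]; exact hx f hf) hpos
        (by linarith) (by linarith) (by rw [pow_succ] at *; linarith)
      refine ⟨m + ⟨k, hk⟩, fun _ => ⟨by simpa [sub_sub] using hk2, ?_⟩⟩
      rw [dist_self_add_right, Submodule.coe_norm, ← pow_succ']
      exact hk1.le
    · exact ⟨m, fun h => absurd h hm⟩
  choose F hF using hstep
  obtain ⟨m₀, hm₀⟩ : ∃ m₀ : M, ‖x - m₀‖ < d + (1 / 2) ^ 0 := by
    obtain ⟨k, hk, -, hk2⟩ := exists_mem_norm_lt_of_lProjection P hPM hPid hP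
      (x := x) (d := d) (r₁ := ‖x‖ + 1) (r₂ := d + (1 / 2) ^ 0) hx (by positivity)
      (by positivity) (by norm_num) (by norm_num; linarith)
    exact ⟨⟨k, hk⟩, hk2⟩
  let u : ℕ → M := fun n => Nat.rec (motive := fun _ => M) m₀ F n
  have hu : ∀ n, ‖x - u n‖ < d + (1 / 2) ^ n := by
    intro n
    induction n with
    | zero => exact hm₀
    | succ n ih => exact (hF n (u n) ih).1
  have hdist : ∀ n, dist (u n) (u (n + 1)) ≤ 1 / 2 * (1 / 2) ^ n := fun n =>
    (hF n (u n) (hu n)).2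
  have : CompleteSpace M := hM.completeSpace_coe
  obtain ⟨m, hm⟩ := cauchySeq_tendsto_of_complete
    (cauchySeq_of_le_geometric (1 / 2) (1 / 2) (by norm_num) hdist)
  refine ⟨m, m.2, ?_⟩
  have h1 : Tendsto (fun n => ‖x - ((u n : M) : E)‖) atTop (𝓝 ‖x - m‖) :=
    (tendsto_const_nhds.sub ((continuous_subtype_val.tendsto m).comp hm)).norm
  have h2 : Tendsto (fun n : ℕ => d + (1 / 2 : ℝ) ^ n) atTop (𝓝 (d + 0)) :=
    tendsto_const_nhds.add (tendsto_pow_atTop_nhds_zero_of_lt_one (by norm_num) (by norm_num))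
  rw [add_zero] at h2
  exact le_of_tendsto_of_tendsto' h1 h2 fun n => (hu n).le

end MIdeal

/-! ### Biorthogonal systems and finite rank operators -/

/-- Finitely many linearly independent functionals have a biorthogonal system. -/
theorem LinearIndependent.exists_biorthogonal {V : Type*} [NormedAddCommGroup V] [NormedSpace ℝ V]
    {n : ℕ} {e : Fin n → StrongDual ℝ V} (he : LinearIndependent ℝ e) :
    ∃ y : Fin n → V, ∀ j k, e j (y k) = if j = k then 1 else 0 := by
  have hsurj : Function.Surjective
      (LinearMap.pi (fun j => (e j : V →ₗ[ℝ] ℝ)) : V →ₗ[ℝ] Fin n → ℝ) := by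
    rw [← LinearMap.range_eq_top]
    by_contra hne
    obtain ⟨φ, hφ, hφ'⟩ := Submodule.exists_dual_map_eq_bot_of_lt_top
      (lt_top_iff_ne_top.2 hne) inferInstance
    have hsum : ∀ c : Fin n → ℝ, φ c = ∑ j, c j * φ (Pi.single j 1) := by
      intro c
      conv_lhs => rw [← Finset.univ_sum_single c]
      rw [map_sum]
      refine Finset.sum_congr rfl fun j _ => ?_
      rw [← smul_eq_mul, ← map_smul, ← Pi.single_smul, smul_eq_mul, mul_one]
    refine hφ (LinearMap.ext fun c => ?_)
    -- A functional vanishing on the range is a linear relation between the `e j`.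
    have hz : ∑ j, φ (Pi.single j 1) • e j = 0 := by
      ext v
      have h1 : φ (LinearMap.pi (fun j => (e j : V →ₗ[ℝ] ℝ)) v) = 0 := by
        have : φ (LinearMap.pi (fun j => (e j : V →ₗ[ℝ] ℝ)) v) ∈
            Submodule.map φ (LinearMap.range (LinearMap.pi fun j => (e j : V →ₗ[ℝ] ℝ))) :=
          Submodule.mem_map_of_mem (LinearMap.mem_range_self _ v)
        rwa [hφ', Submodule.mem_bot] at this
      rw [hsum] at h1
      simpa [sum_apply, mul_comm] using h1
    have h0 := Fintype.linearIndependent_iff.1 he _ hz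
    rw [hsum]
    simp [h0]
  choose y hy using fun k => hsurj (Pi.single k 1)
  refine ⟨y, fun j k => ?_⟩
  have := congrFun (hy k) j
  simpa [Pi.single_apply] using this

/-- A bounded operator of finite rank is a finite sum of rank one operators. -/
theorem ContinuousLinearMap.exists_eq_sum_of_finiteDimensional_range {V W : Type*}
    [NormedAddCommGroup V] [NormedSpace ℝ V] [NormedAddCommGroup W] [NormedSpace ℝ W]
    (q : V →L[ℝ] W) (hq : FiniteDimensional ℝ (LinearMap.range (q : V →ₗ[ℝ] W))) :
    ∃ (n : ℕ) (e : Fin n → W) (φ : Fin n → StrongDual ℝ V), LinearIndependent ℝ e ∧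
      (∀ j, e j ∈ LinearMap.range (q : V →ₗ[ℝ] W)) ∧ ∀ v, q v = ∑ j, φ j v • e j := by
  let b := Module.finBasis ℝ (LinearMap.range (q : V →ₗ[ℝ] W))
  let q' : V →L[ℝ] LinearMap.range (q : V →ₗ[ℝ] W) :=
    q.codRestrict _ fun v => LinearMap.mem_range_self (q : V →ₗ[ℝ] W) v
  refine ⟨_, fun j => b j, fun j => (LinearMap.toContinuousLinearMap (b.coord j)).comp q', ?_,
    fun j => (b j).2, fun v => ?_⟩
  · exact b.linearIndependent.map' (Submodule.subtype _) (Submodule.ker_subtype _)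
  · have := congrArg Subtype.val (b.sum_repr (q' v))
    rw [Submodule.coe_sum] at this
    exact this.symm

/-! ### Compact operators and their dual -/

section CompactOperators

variable {X Y : Type*} [NormedAddCommGroup X] [NormedSpace ℝ X]
  [NormedAddCommGroup Y] [NormedSpace ℝ Y]

namespace CompactOp

/-- The inclusion of the compact operators into the bounded operators. -/
noncomputable def toCLM : CompactOp X Y →ₗᵢ[ℝ] (X →L[ℝ] Y) where
  toLinearMap := (compactOperator (RingHom.id ℝ) X Y).subtype
  norm_map' _ := rfl

theorem isCompactOperator_toCLM (T : CompactOp X Y) : IsCompactOperator (toCLM T) := T.2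

/-- A bounded operator which is compact, as an element of `CompactOp`. -/
noncomputable def ofCLM (T : X →L[ℝ] Y) (hT : IsCompactOperator T) : CompactOp X Y := ⟨T, hT⟩

@[simp] theorem toCLM_ofCLM (T : X →L[ℝ] Y) (hT : IsCompactOperator T) :
    toCLM (ofCLM T hT) = T := rfl

theorem toCLM_injective : Function.Injective (toCLM : CompactOp X Y → X →L[ℝ] Y) :=
  toCLM.injective

theorem isClosed_range_toCLM [CompleteSpace Y] :
    IsClosed (Set.range (toCLM : CompactOp X Y → X →L[ℝ] Y)) := by
  have : Set.range (toCLM : CompactOp X Y → X →L[ℝ] Y) =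
      {f : X →L[ℝ] Y | IsCompactOperator f} := by
    ext f
    exact ⟨by rintro ⟨T, rfl⟩; exact T.isCompactOperator_toCLM, fun h => ⟨ofCLM f h, rfl⟩⟩
  rw [this]
  exact isClosed_setOfPred_isCompactOperator

instance [CompleteSpace Y] : CompleteSpace (CompactOp X Y) := by
  rw [completeSpace_iff_isComplete_range toCLM.isometry.isUniformInducing]
  exact isClosed_range_toCLM.isComplete

/-- Composition with a bounded operator on the right. -/
noncomputable def compRight (S : X →L[ℝ] X) : CompactOp X Y →ₗ[ℝ] CompactOp X Y where
  toFun T := ofCLM ((toCLM T).comp S) (T.isCompactOperator_toCLM.comp_clm S)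
  map_add' T₁ T₂ := toCLM_injective (by ext x; rfl)
  map_smul' c T := toCLM_injective (by ext x; rfl)

@[simp] theorem toCLM_compRight (S : X →L[ℝ] X) (T : CompactOp X Y) :
    toCLM (compRight S T) = (toCLM T).comp S := rfl

theorem isCompactOperator_smulRight (φ : StrongDual ℝ X) (y : Y) :
    IsCompactOperator (φ.smulRight y) :=
  (isCompactOperator_id (E := ℝ)).comp_clm φ |>.continuous_comp
    (g := fun c : ℝ => c • y) (by fun_prop)

/-- The operator `x ↦ φ x • y` of rank one, as a bilinear function of `φ` and `y`. -/
noncomputable def rankOne : StrongDual ℝ X →L[ℝ] Y →L[ℝ] CompactOp X Y :=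
  LinearMap.mkContinuous₂
    (LinearMap.mk₂ ℝ (fun φ y => ofCLM (φ.smulRight y) (isCompactOperator_smulRight φ y))
      (fun φ₁ φ₂ y => toCLM_injective (by ext x; simp [add_smul]))
      (fun c φ y => toCLM_injective (by ext x; simp [mul_smul]))
      (fun φ y₁ y₂ => toCLM_injective (by ext x; simp))
      (fun c φ y => toCLM_injective (by ext x; exact smul_comm (φ x) c y)))
    1 (fun φ y => by
      rw [one_mul, ← toCLM.norm_map]
      exact (ContinuousLinearMap.norm_smulRight_apply φ y).le)

@[simp] theorem toCLM_rankOne (φ : StrongDual ℝ X) (y : Y) :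
    toCLM (rankOne φ y) = φ.smulRight y := rfl

/-- The functional `T ↦ ψ (T x)`, as a bilinear function of `x` and `ψ`. -/
noncomputable def evalDual : X →L[ℝ] StrongDual ℝ Y →L[ℝ] StrongDual ℝ (CompactOp X Y) :=
  LinearMap.mkContinuous₂
    (LinearMap.mk₂ ℝ (fun x ψ =>
        (ψ.comp (ContinuousLinearMap.apply ℝ Y x)).comp toCLM.toContinuousLinearMap)
      (fun x₁ x₂ ψ => by ext T; simp)
      (fun c x ψ => by ext T; simp)
      (fun x ψ₁ ψ₂ => by ext T; simp)
      (fun c x ψ => by ext T; simp))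
    1 (fun x ψ => by
      refine ContinuousLinearMap.opNorm_le_bound _ (by positivity) fun T => ?_
      refine (ψ.le_opNorm _).trans ?_
      have := (toCLM T).le_opNorm x
      rw [toCLM.norm_map] at this
      calc ‖ψ‖ * ‖toCLM T x‖ ≤ ‖ψ‖ * (‖T‖ * ‖x‖) := by gcongr
        _ = 1 * ‖x‖ * ‖ψ‖ * ‖T‖ := by ring)

@[simp] theorem evalDual_apply (x : X) (ψ : StrongDual ℝ Y) (T : CompactOp X Y) :
    evalDual x ψ T = ψ (toCLM T x) := rfl

/-- The operator `X* → Y*` associated with a functional on the compact operators. -/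
noncomputable def toDualOp :
    StrongDual ℝ (CompactOp X Y) →ₗ[ℝ] (StrongDual ℝ X →L[ℝ] StrongDual ℝ Y) where
  toFun f := (ContinuousLinearMap.compL ℝ Y (CompactOp X Y) ℝ f).comp rankOne
  map_add' f g := by ext φ y; simp
  map_smul' c f := by ext φ y; simp

@[simp] theorem toDualOp_apply (f : StrongDual ℝ (CompactOp X Y)) (φ : StrongDual ℝ X) (y : Y) :
    toDualOp f φ y = f (rankOne φ y) := rfl

theorem toDualOp_evalDual (x : X) (ψ : StrongDual ℝ Y) (φ : StrongDual ℝ X) :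
    toDualOp (evalDual x ψ) φ = φ x • ψ := by
  ext y
  simp

end CompactOp

open CompactOp

/-! ### Finite rank approximation and lifting of L-projections -/

/-- Finitely many functionals are almost fixed by a contraction of finite rank. -/
theorem HasMetricApproximationProperty.exists_norm_comp_sub_le
    (hX : IsReflexiveSpace X) (hmap : HasMetricApproximationProperty X)
    {ι : Type*} [Fintype ι] (φ : ι → StrongDual ℝ X) {ε : ℝ} (hε : 0 < ε) :
    ∃ S : X →L[ℝ] X, FiniteDimensional ℝ (LinearMap.range (S : X →ₗ[ℝ] X)) ∧ ‖S‖ ≤ 1 ∧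
      ∀ j, ‖(φ j).comp S - φ j‖ ≤ ε := by
  classical
  let K : Set (X →L[ℝ] X) :=
    {S | FiniteDimensional ℝ (LinearMap.range (S : X →ₗ[ℝ] X)) ∧ ‖S‖ ≤ 1}
  have hK : Convex ℝ K := by
    rintro S ⟨hS, hS1⟩ S' ⟨hS', hS1'⟩ a b ha hb hab
    refine ⟨?_, ?_⟩
    · refine Submodule.finiteDimensional_of_le (S₂ := LinearMap.range (S : X →ₗ[ℝ] X) ⊔
        LinearMap.range (S' : X →ₗ[ℝ] X)) ?_
      rintro _ ⟨x, rfl⟩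
      exact Submodule.add_mem_sup (Submodule.smul_mem _ a ⟨x, rfl⟩)
        (Submodule.smul_mem _ b ⟨x, rfl⟩)
    · refine (norm_add_le _ _).trans ?_
      rw [norm_smul, norm_smul, Real.norm_of_nonneg ha, Real.norm_of_nonneg hb]
      nlinarith
  let Λ : (X →L[ℝ] X) →ₗ[ℝ] (ι → StrongDual ℝ X) :=
    { toFun := fun S j => (φ j).comp S
      map_add' := fun S S' => by ext j x; simp
      map_smul' := fun c S => by ext j x; simp }
  -- By reflexivity a separating functional is given by finitely many points of `X`, and
  -- approximating the identity on those points contradicts separation.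
  have hmem : φ ∈ closure (Λ '' K) := by
    by_contra hcon
    obtain ⟨g, u, hg, hu⟩ := geometric_hahn_banach_closed_point
      (hK.linear_image Λ).closure isClosed_closure hcon
    choose x hx using fun j => hX (g.comp (ContinuousLinearMap.single ℝ (fun _ => StrongDual ℝ X) j))
    have hgx : ∀ v : ι → StrongDual ℝ X, g v = ∑ j, v j (x j) := by
      intro v
      conv_lhs => rw [← Finset.univ_sum_single v]
      rw [map_sum]
      refine Finset.sum_congr rfl fun j _ => ?_
      exact (DFunLike.congr_fun (hx j) (v j)).symm
    have hpos : 0 < ∑ j, ‖φ j‖ + 1 := by positivity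
    obtain ⟨S, hS, hS1, hS2⟩ := hmap (Set.range x) (Set.finite_range x).isCompact
      ((g φ - u) / (∑ j, ‖φ j‖ + 1)) (div_pos (by linarith) hpos)
    have h1 := hg (Λ S) (subset_closure ⟨S, ⟨hS, hS1⟩, rfl⟩)
    have h2 : g φ - g (Λ S) ≤ ∑ j, ‖φ j‖ * ((g φ - u) / (∑ j, ‖φ j‖ + 1)) := by
      rw [hgx, hgx, ← Finset.sum_sub_distrib]
      refine Finset.sum_le_sum fun j _ => ?_
      have : φ j (x j) - Λ S j (x j) = φ j (x j - S (x j)) := by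
        rw [map_sub]; rfl
      rw [this]
      refine (le_abs_self _).trans (((φ j).le_opNorm _).trans ?_)
      rw [norm_sub_rev]
      gcongr
      rw [← hgx]
      exact hS2 _ ⟨j, rfl⟩
    rw [← Finset.sum_mul, ← mul_div_assoc, le_div_iff₀ hpos] at h2
    nlinarith
  obtain ⟨_, ⟨S, hS, rfl⟩, hd⟩ := Metric.mem_closure_iff.1 hmem ε hε
  refine ⟨S, hS.1, hS.2, fun j => ?_⟩
  rw [norm_sub_rev, ← dist_eq_norm]
  exact (dist_le_pi_dist φ (Λ S) j).trans hd.le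

/-- A form of Schauder's theorem: the adjoint of a compact operator maps the unit ball to a totally
bounded set. -/
theorem CompactOp.totallyBounded_range_comp (T : CompactOp X Y) :
    TotallyBounded ((fun ψ : StrongDual ℝ Y => ψ.comp (toCLM T)) '' Metric.closedBall 0 1) := by
  rw [Metric.totallyBounded_iff]
  intro ε hε
  have hK : TotallyBounded (toCLM T '' Metric.closedBall 0 1) :=
    ((T.isCompactOperator_toCLM.isCompact_closure_image_closedBall
      (f := ((toCLM T : X →L[ℝ] Y) : X →ₗ[ℝ] Y)) 1).totallyBounded).subset subset_closure
  obtain ⟨t, htf, ht⟩ := Metric.totallyBounded_iff.1 hK (ε / 8) (by positivity)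
  have := htf.fintype
  -- For `ψ` in the dual unit ball, the values on the finite net `t` determine `ψ ∘ T` up to a small
  -- error, and they form a bounded set in finite dimension.
  let R : StrongDual ℝ Y →ₗ[ℝ] (t → ℝ) :=
    { toFun := fun ψ y => ψ y
      map_add' := fun _ _ => rfl
      map_smul' := fun _ _ => rfl }
  have hRb : Bornology.IsBounded (R '' Metric.closedBall 0 1) := by
    rw [isBounded_iff_forall_norm_le]
    refine ⟨∑ y : t, ‖(y : Y)‖, ?_⟩
    rintro _ ⟨ψ, hψ, rfl⟩
    rw [pi_norm_le_iff_of_nonneg (by positivity)]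
    intro y
    have h1 : ‖R ψ y‖ ≤ 1 * ‖(y : Y)‖ := ψ.le_of_opNorm_le (by simpa using hψ) y
    rw [one_mul] at h1
    exact h1.trans (Finset.single_le_sum (f := fun y : t => ‖(y : Y)‖)
      (fun _ _ => norm_nonneg _) (Finset.mem_univ y))
  obtain ⟨s, hs, hsf, hst⟩ := Metric.finite_approx_of_totallyBounded
    (hRb.isCompact_closure.totallyBounded.subset subset_closure) (ε / 8) (by positivity)
  have hs' : ∀ c ∈ s, ∃ ψ : StrongDual ℝ Y, ψ ∈ Metric.closedBall 0 1 ∧ R ψ = c :=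
    fun c hc => hs hc
  choose! G hG using hs'
  refine ⟨(fun c => (G c).comp (toCLM T)) '' s, hsf.image _, ?_⟩
  rintro _ ⟨ψ, hψ, rfl⟩
  obtain ⟨c, hc, hψc⟩ := mem_iUnion₂.1 (hst ⟨ψ, hψ, rfl⟩)
  refine mem_iUnion₂.2 ⟨_, ⟨c, hc, rfl⟩, ?_⟩
  obtain ⟨hG1, hG2⟩ := hG c hc
  rw [Metric.mem_ball, dist_eq_norm] at hψc ⊢
  have h2 : ‖ψ - G c‖ ≤ 2 := by
    rw [mem_closedBall_zero_iff] at hψ hG1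
    exact (norm_sub_le _ _).trans (by linarith)
  have h3 : ‖ψ.comp (toCLM T) - (G c).comp (toCLM T)‖ ≤ ε / 2 := by
    refine ContinuousLinearMap.opNorm_le_of_unit_norm (by positivity) fun x hx => ?_
    obtain ⟨y, hy, hxy⟩ := mem_iUnion₂.1 (ht ⟨x, by simp [hx], rfl⟩)
    rw [Metric.mem_ball, dist_eq_norm] at hxy
    have e1 : (ψ.comp (toCLM T) - (G c).comp (toCLM T)) x
        = (ψ - G c) (toCLM T x - y) + (R ψ - c) ⟨y, hy⟩ := by
      have e0 : (R ψ - c) ⟨y, hy⟩ = ψ y - G c y := by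
        rw [Pi.sub_apply, ← congrFun hG2 ⟨y, hy⟩]
        rfl
      rw [e0]
      simp only [sub_apply, ContinuousLinearMap.comp_apply, map_sub]
      ring
    rw [e1]
    calc ‖(ψ - G c) (toCLM T x - y) + (R ψ - c) ⟨y, hy⟩‖
        ≤ ‖ψ - G c‖ * ‖toCLM T x - y‖ + ‖R ψ - c‖ :=
          (norm_add_le _ _).trans (add_le_add ((ψ - G c).le_opNorm _) (norm_le_pi_norm _ _))
      _ ≤ 2 * (ε / 8) + ε / 8 := by gcongr
      _ ≤ ε / 2 := by linarith
  linarith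

/-- Two compact operators are almost fixed by composition with a contraction of finite rank. -/
theorem HasMetricApproximationProperty.exists_norm_compRight_sub_le
    (hX : IsReflexiveSpace X) (hmap : HasMetricApproximationProperty X)
    (T₁ T₂ : CompactOp X Y) {ε : ℝ} (hε : 0 < ε) :
    ∃ S : X →L[ℝ] X, FiniteDimensional ℝ (LinearMap.range (S : X →ₗ[ℝ] X)) ∧ ‖S‖ ≤ 1 ∧
      ‖compRight S T₁ - T₁‖ ≤ ε ∧ ‖compRight S T₂ - T₂‖ ≤ ε := by
  -- `‖T ∘ S - T‖` is tested by the functionals `χ = ψ ∘ T` with `‖ψ‖ ≤ 1`. They form a totally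
  -- bounded set, so `S` need only almost fix a finite net.
  obtain ⟨t, htf, ht⟩ := Metric.totallyBounded_iff.1
    (T₁.totallyBounded_range_comp.union T₂.totallyBounded_range_comp) (ε / 3) (by positivity)
  have := htf.fintype
  obtain ⟨S, hS, hS1, hSt⟩ := hmap.exists_norm_comp_sub_le hX (fun φ : t => (φ : StrongDual ℝ X))
    (ε := ε / 3) (by positivity)
  have key : ∀ T : CompactOp X Y,
      ((fun ψ : StrongDual ℝ Y => ψ.comp (toCLM T)) '' Metric.closedBall 0 1 ⊆
        ⋃ φ ∈ t, Metric.ball φ (ε / 3)) → ‖compRight S T - T‖ ≤ ε := by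
    intro T hT
    rw [← toCLM.norm_map, map_sub, toCLM_compRight]
    refine ContinuousLinearMap.opNorm_le_bound _ hε.le fun x => ?_
    obtain ⟨ψ, hψ, hψx⟩ := exists_dual_vector'' ℝ (((toCLM T).comp S - toCLM T) x)
    obtain ⟨φ, hφ, hφψ⟩ := mem_iUnion₂.1 (hT ⟨ψ, by simpa using hψ, rfl⟩)
    rw [Metric.mem_ball, dist_eq_norm] at hφψ
    set χ : StrongDual ℝ X := ψ.comp (toCLM T) with hχ
    have e1 : χ.comp S - χ = (χ - φ).comp S + (φ.comp S - φ) - (χ - φ) := by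
      ext z; simp
    have e2 : ‖χ.comp S - χ‖ ≤ ε := by
      rw [e1]
      have h1 : ‖(χ - φ).comp S‖ ≤ ε / 3 := by
        refine ((χ - φ).opNorm_comp_le S).trans ?_
        nlinarith [norm_nonneg (χ - φ), norm_nonneg S]
      have h2 := hSt ⟨φ, hφ⟩
      have h3 := norm_sub_le ((χ - φ).comp S + (φ.comp S - φ)) (χ - φ)
      have h4 := norm_add_le ((χ - φ).comp S) (φ.comp S - φ)
      simp only at h2
      linarith
    have e3 : ‖((toCLM T).comp S - toCLM T) x‖ = (χ.comp S - χ) x := by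
      rw [show ‖((toCLM T).comp S - toCLM T) x‖ = ψ (((toCLM T).comp S - toCLM T) x) from
        hψx.symm, hχ]
      simp
    rw [e3]
    exact (le_abs_self _).trans (ContinuousLinearMap.le_of_opNorm_le _ e2 x)
  exact ⟨S, hS, hS1, key T₁ (subset_union_left.trans ht), key T₂ (subset_union_right.trans ht)⟩

/-- A functional composed with a contraction of finite rank is nuclear, with almost no loss in the
norm. -/
theorem CompactOp.exists_comp_compRight_eq_sum (f : StrongDual ℝ (CompactOp X Y)) {S : X →L[ℝ] X}
    (hS : FiniteDimensional ℝ (LinearMap.range (S : X →ₗ[ℝ] X))) (hS1 : ‖S‖ ≤ 1)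
    {η : ℝ} (hη : 0 < η) (hη1 : η < 1) :
    ∃ (n : ℕ) (x : Fin n → X) (ψ : Fin n → StrongDual ℝ Y),
      (∀ k, ‖x k‖ ≤ 1) ∧ (∀ T, f (compRight S T) = ∑ k, ψ k (toCLM T (x k))) ∧
      ∑ k, ‖ψ k‖ ≤ ‖f‖ / (1 - η) := by
  classical
  let W := LinearMap.range (S : X →ₗ[ℝ] X)
  have : ProperSpace W := FiniteDimensional.proper_real W
  obtain ⟨t, htb, htf, ht⟩ := Metric.finite_approx_of_totallyBounded
    (isCompact_closedBall (0 : W) 1).totallyBounded η hη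
  obtain ⟨n, v, rfl⟩ : ∃ (n : ℕ) (v : Fin n → W), Set.range v = t := by
    have := htf.fintype
    exact ⟨_, fun k => ((Fintype.equivFin t).symm k : W), by
      rw [Set.range_comp' Subtype.val, (Fintype.equivFin t).symm.range_eq_univ, image_univ,
        Subtype.range_coe]⟩
  -- Values on an `η`-net of the unit ball of `W` control the restriction of `T` to `W` up to the
  -- factor `1 / (1 - η)`, so `f ∘ compRight S` extends through `Ψ` to a functional on a sup-normed
  -- power of `Y`.
  let Ψ : CompactOp X Y →ₗ[ℝ] (Fin n → Y) :=
    { toFun := fun T k => toCLM T (v k : W)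
      map_add' := fun _ _ => rfl
      map_smul' := fun _ _ => rfl }
  have hΨ : ∀ T, ‖compRight S T‖ ≤ ‖Ψ T‖ / (1 - η) := by
    intro T
    let R : W →L[ℝ] Y := (toCLM T).comp W.subtypeL
    have h1 : ‖R‖ ≤ ‖Ψ T‖ + ‖R‖ * η := by
      refine ContinuousLinearMap.opNorm_le_of_unit_norm (by positivity) fun w hw => ?_
      obtain ⟨_, ⟨k, rfl⟩, hwv⟩ :=
        mem_iUnion₂.1 (ht (show w ∈ Metric.closedBall 0 1 by simp [hw]))
      rw [Metric.mem_ball, dist_eq_norm] at hwv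
      have h2 : R w = R (v k) + R (w - v k) := by rw [← map_add, add_sub_cancel]
      rw [h2]
      refine (norm_add_le _ _).trans (add_le_add (norm_le_pi_norm (Ψ T) k) ?_)
      exact (R.le_opNorm _).trans (by gcongr)
    have h3 : ‖compRight S T‖ ≤ ‖R‖ := by
      rw [← toCLM.norm_map, toCLM_compRight]
      refine ContinuousLinearMap.opNorm_le_bound _ (norm_nonneg R) fun x => ?_
      refine (R.le_opNorm ⟨S x, x, rfl⟩).trans ?_
      have : ‖S x‖ ≤ 1 * ‖x‖ := S.le_of_opNorm_le hS1 x
      rw [one_mul] at this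
      gcongr
      exact this
    rw [le_div_iff₀ (by linarith)]
    nlinarith [norm_nonneg R]
  obtain ⟨g, hg, hgΨ⟩ := exists_dual_comp_eq_of_le_norm Ψ
    ((f : CompactOp X Y →ₗ[ℝ] ℝ).comp (compRight S)) (C := ‖f‖ / (1 - η))
    (div_nonneg (norm_nonneg _) (by linarith)) (fun T => by
      have h1 := f.le_opNorm (compRight S T)
      refine h1.trans ?_
      rw [div_mul_eq_mul_div, ← mul_div_assoc']
      gcongr
      exact hΨ T)
  refine ⟨n, fun k => (v k : W),
    fun k => g.comp (ContinuousLinearMap.single ℝ (fun _ : Fin n => Y) k), ?_, ?_,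
    (sum_norm_comp_single_le g).trans hg⟩
  · intro k
    simpa using htb ⟨k, rfl⟩
  · intro T
    have h1 := hgΨ T
    rw [← Finset.univ_sum_single (Ψ T), map_sum] at h1
    exact h1.symm

/-- A functional on the compact operators is determined by its values at operators of rank one. -/
theorem CompactOp.toDualOp_injective (hX : IsReflexiveSpace X)
    (hmap : HasMetricApproximationProperty X) :
    Function.Injective (toDualOp : StrongDual ℝ (CompactOp X Y) →ₗ[ℝ] _) := by
  rw [injective_iff_map_eq_zero]
  intro f hf
  ext T
  rw [zero_apply, ← norm_le_zero_iff]
  refine le_of_forall_pos_le_add fun ε hε => ?_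
  obtain ⟨S, hS, -, hST, -⟩ := hmap.exists_norm_compRight_sub_le hX T T
    (ε := ε / (‖f‖ + 1)) (by positivity)
  obtain ⟨n, e, φ, -, -, hSe⟩ := S.exists_eq_sum_of_finiteDimensional_range hS
  have h1 : compRight S T = ∑ j, rankOne (φ j) (toCLM T (e j)) := by
    apply toCLM_injective
    ext x
    simp [map_sum, hSe]
  have h2 : f (compRight S T) = 0 := by
    rw [h1, map_sum]
    refine Finset.sum_eq_zero fun j _ => ?_
    rw [← toDualOp_apply, hf]
    rfl
  have h3 : f T = -f (compRight S T - T) := by rw [map_sub, h2]; ring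
  rw [h3, norm_neg, zero_add]
  refine (f.le_opNorm _).trans ?_
  calc ‖f‖ * ‖compRight S T - T‖ ≤ (‖f‖ + 1) * (ε / (‖f‖ + 1)) := by gcongr; linarith
    _ = ε := by field_simp

/-- A finite rank L-projection of `Y*` induces an L-projection of the dual of the space of compact
operators. -/
theorem CompactOp.exists_lProjection (hX : IsReflexiveSpace X)
    (hmap : HasMetricApproximationProperty X) (q : StrongDual ℝ Y →L[ℝ] StrongDual ℝ Y)
    (hq : FiniteDimensional ℝ (LinearMap.range (q : StrongDual ℝ Y →ₗ[ℝ] StrongDual ℝ Y)))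
    (hqn : ∀ ψ, ‖q ψ‖ + ‖ψ - q ψ‖ ≤ ‖ψ‖) :
    ∃ P : StrongDual ℝ (CompactOp X Y) →ₗ[ℝ] StrongDual ℝ (CompactOp X Y),
      (∀ f, toDualOp (P f) = q.comp (toDualOp f)) ∧ ∀ f, ‖P f‖ + ‖f - P f‖ ≤ ‖f‖ := by
  obtain ⟨n, e, φ, -, -, hqe⟩ := q.exists_eq_sum_of_finiteDimensional_range hq
  let J : X ≃ₗ[ℝ] StrongDual ℝ (StrongDual ℝ X) :=
    LinearEquiv.ofBijective (NormedSpace.inclusionInDoubleDual ℝ X).toLinearMap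
      ⟨(NormedSpace.inclusionInDoubleDualLi ℝ (E := X)).injective, hX⟩
  have hJ : ∀ (Φ : StrongDual ℝ (StrongDual ℝ X)) (χ : StrongDual ℝ X),
      χ (J.symm Φ) = Φ χ := by
    intro Φ χ
    conv_rhs => rw [← J.apply_symm_apply Φ]
    rfl
  -- Each `φ j ∘ toDualOp f` lies in the bidual of `X`, hence is a point of `X`.
  let P : StrongDual ℝ (CompactOp X Y) →ₗ[ℝ] StrongDual ℝ (CompactOp X Y) :=
    { toFun := fun f => ∑ j, evalDual (J.symm ((φ j).comp (toDualOp f))) (e j)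
      map_add' := fun f g => by
        simp [ContinuousLinearMap.comp_add, Finset.sum_add_distrib]
      map_smul' := fun c f => by
        simp [Finset.smul_sum] }
  have hPapply : ∀ f T, P f T = ∑ j, φ j (toDualOp f ((e j).comp (toCLM T))) := by
    intro f T
    change (∑ j, evalDual (J.symm ((φ j).comp (toDualOp f))) (e j)) T = _
    rw [sum_apply]
    refine Finset.sum_congr rfl fun j _ => ?_
    exact hJ ((φ j).comp (toDualOp f)) ((e j).comp (toCLM T))
  refine ⟨P, fun f => ?_, fun f => ?_⟩
  · ext χ y
    rw [toDualOp_apply, hPapply, ContinuousLinearMap.comp_apply, hqe, sum_apply]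
    refine Finset.sum_congr rfl fun j _ => ?_
    have : (e j).comp (toCLM (rankOne χ y)) = e j y • χ := by
      ext x; simp [mul_comm]
    rw [this, map_smul, map_smul, smul_apply, smul_eq_mul, smul_eq_mul, mul_comm]
  · have main : ∀ T₁ T₂ : CompactOp X Y, ‖T₁‖ < 1 → ‖T₂‖ < 1 →
        P f T₁ + (f - P f) T₂ ≤ ‖f‖ := by
      intro T₁ T₂ hT₁ hT₂
      have hη : ∀ η : ℝ, η ∈ Ioo (0 : ℝ) 1 → P f T₁ + (f - P f) T₂ ≤
          ‖f‖ / (1 - η) + (‖P f‖ + ‖f - P f‖) * η := by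
        rintro η ⟨hη0, hη1⟩
        obtain ⟨S, hS, hS1, hST₁, hST₂⟩ := hmap.exists_norm_compRight_sub_le hX T₁ T₂ hη0
        obtain ⟨m, x, ψ, hx, hfx, hψ⟩ := exists_comp_compRight_eq_sum f hS hS1 hη0 hη1
        have hB : ∀ χ : StrongDual ℝ X, toDualOp f (χ.comp S) = ∑ k, χ (x k) • ψ k := by
          intro χ
          ext y
          have : rankOne (χ.comp S) y = compRight S (rankOne χ y) :=
            toCLM_injective (by ext z; simp)
          rw [toDualOp_apply, this, hfx, sum_apply]
          simp
        -- On the nuclear representation `P` acts by applying `q` to each `ψ k`, so the norm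
        -- inequality for `q` can be used term by term.
        have hPS : ∀ T, P f (compRight S T) = ∑ k, q (ψ k) (toCLM T (x k)) := by
          intro T
          rw [hPapply]
          have : ∀ j, φ j (toDualOp f ((e j).comp (toCLM (compRight S T)))) =
              ∑ k, φ j (ψ k) * e j (toCLM T (x k)) := by
            intro j
            have h1 : (e j).comp (toCLM (compRight S T)) = ((e j).comp (toCLM T)).comp S := rfl
            rw [h1, hB, map_sum]
            refine Finset.sum_congr rfl fun k _ => ?_
            rw [map_smul, smul_eq_mul, mul_comm]
            rfl
          simp_rw [this]
          rw [Finset.sum_comm]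
          refine Finset.sum_congr rfl fun k _ => ?_
          rw [hqe, sum_apply]
          rfl
        have hTx : ∀ (T : CompactOp X Y) k (χ : StrongDual ℝ Y), ‖T‖ < 1 →
            χ (toCLM T (x k)) ≤ ‖χ‖ := by
          intro T k χ hT
          refine (le_abs_self _).trans ((χ.le_opNorm _).trans ?_)
          refine mul_le_of_le_one_right (norm_nonneg _) ?_
          refine ((toCLM T).le_opNorm _).trans ?_
          rw [toCLM.norm_map]
          exact mul_le_one₀ hT.le (norm_nonneg _) (hx k)
        have h1 : P f (compRight S T₁) + (f - P f) (compRight S T₂) ≤ ‖f‖ / (1 - η) := by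
          rw [sub_apply, hPS, hPS, hfx, ← Finset.sum_sub_distrib, ← Finset.sum_add_distrib]
          refine (Finset.sum_le_sum fun k _ => ?_).trans hψ
          refine le_trans ?_ (hqn (ψ k))
          rw [← sub_apply]
          exact add_le_add (hTx _ _ _ hT₁) (hTx _ _ _ hT₂)
        have h2 : ∀ (g : StrongDual ℝ (CompactOp X Y)) (T : CompactOp X Y),
            ‖compRight S T - T‖ ≤ η → g T ≤ g (compRight S T) + ‖g‖ * η := by
          intro g T hT
          have h3 := (neg_le_abs _).trans (g.le_opNorm (compRight S T - T))
          rw [map_sub] at h3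
          have h4 : ‖g‖ * ‖compRight S T - T‖ ≤ ‖g‖ * η := by gcongr
          linarith
        have h5 := h2 (P f) T₁ hST₁
        have h6 := h2 (f - P f) T₂ hST₂
        linarith
      have hlim : Tendsto (fun η : ℝ => ‖f‖ / (1 - η) + (‖P f‖ + ‖f - P f‖) * η) (𝓝[>] 0)
          (𝓝 ‖f‖) := by
        have : ContinuousAt (fun η : ℝ => ‖f‖ / (1 - η) + (‖P f‖ + ‖f - P f‖) * η) 0 := by
          fun_prop (disch := norm_num)
        have h := this.tendsto.mono_left (nhdsWithin_le_nhds (s := Ioi 0))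
        simpa using h
      refine ge_of_tendsto hlim ?_
      filter_upwards [Ioo_mem_nhdsGT (zero_lt_one (α := ℝ))] with η h
      exact hη η h
    have h1 : ∀ T₁ : CompactOp X Y, ‖T₁‖ < 1 → P f T₁ ≤ ‖f‖ - ‖f - P f‖ := by
      intro T₁ hT₁
      have := mul_norm_le_of_forall_norm_lt (f - P f) (c := ‖f‖ - P f T₁) one_pos
        (fun T₂ hT₂ => by linarith [main T₁ T₂ hT₁ hT₂])
      linarith
    have := mul_norm_le_of_forall_norm_lt (P f) one_pos h1
    linarith

end CompactOperators

/-! ### Annihilators carried by finitely many functionals on `Y` -/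

section FactorReflexive

variable {X Y : Type*} [NormedAddCommGroup X] [NormedSpace ℝ X]
  [NormedAddCommGroup Y] [NormedSpace ℝ Y]

open CompactOp

/-- The annihilator of a subspace, as a subspace of the strong dual. -/
def annihilatorSubmodule {E : Type*} [NormedAddCommGroup E] [NormedSpace ℝ E]
    (Z : Submodule ℝ E) : Submodule ℝ (StrongDual ℝ E) where
  carrier := annihilatorSubspace Z
  add_mem' {f g} hf hg z hz := by rw [add_apply, hf z hz, hg z hz, add_zero]
  zero_mem' _ _ := rfl
  smul_mem' c f hf z hz := by rw [smul_apply, hf z hz, smul_zero]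

theorem isClosed_annihilatorSubmodule {E : Type*} [NormedAddCommGroup E] [NormedSpace ℝ E]
    (Z : Submodule ℝ E) : IsClosed (annihilatorSubmodule Z : Set (StrongDual ℝ E)) := by
  have : (annihilatorSubmodule Z : Set (StrongDual ℝ E)) = ⋂ z ∈ Z, {f | f z = 0} := by
    ext f
    simp only [mem_iInter]
    rfl
  rw [this]
  exact isClosed_biInter fun z _ => isClosed_eq (by fun_prop) continuous_const

/-- The compact operators annihilated on the left by given functionals. -/
def CompactOp.leftKer {n : ℕ} (e : Fin n → StrongDual ℝ Y) : Submodule ℝ (CompactOp X Y) where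
  carrier := {T | ∀ j x, e j (toCLM T x) = 0}
  add_mem' {S T} hS hT j x := by rw [map_add, add_apply, map_add, hS, hT, add_zero]
  zero_mem' j x := by simp
  smul_mem' c T hT j x := by rw [map_smul, smul_apply, map_smul, hT, smul_zero]

theorem CompactOp.isClosed_leftKer {n : ℕ} (e : Fin n → StrongDual ℝ Y) :
    IsClosed (leftKer (X := X) e : Set (CompactOp X Y)) := by
  have : (leftKer (X := X) e : Set (CompactOp X Y)) =
      ⋂ j, ⋂ x, {T | evalDual x (e j) T = 0} := by
    ext T
    simp only [mem_iInter]
    rfl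
  rw [this]
  exact isClosed_iInter fun j => isClosed_iInter fun x => isClosed_eq (by fun_prop) continuous_const

theorem CompactOp.sum_evalDual_mem_annihilator {n : ℕ} (e : Fin n → StrongDual ℝ Y)
    (x : Fin n → X) : ∑ j, evalDual (x j) (e j) ∈ annihilatorSubspace (leftKer (X := X) e) := by
  intro T hT
  rw [sum_apply]
  exact Finset.sum_eq_zero fun j _ => hT j (x j)

/-- With `y` biorthogonal to `e`, subtracting `∑ j, rankOne (e j ∘ T) (y j)` from `T` lands in
`leftKer e`. So `f` is determined by the functionals `χ ↦ f (rankOne χ (y j))` on `X*`, which are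
points of `X`. -/
theorem CompactOp.exists_eq_sum_evalDual_of_mem_annihilator (hX : IsReflexiveSpace X) {n : ℕ}
    {e : Fin n → StrongDual ℝ Y} (he : LinearIndependent ℝ e)
    {f : StrongDual ℝ (CompactOp X Y)} (hf : f ∈ annihilatorSubspace (leftKer (X := X) e)) :
    ∃ x : Fin n → X, f = ∑ j, evalDual (x j) (e j) := by
  obtain ⟨y, hy⟩ := he.exists_biorthogonal
  choose x hx using fun j => hX (f.comp (rankOne.flip (y j)))
  refine ⟨x, ?_⟩
  ext T
  have hmem : T - ∑ j, rankOne ((e j).comp (toCLM T)) (y j) ∈ leftKer (X := X) e := by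
    intro k z
    simp [map_sub, map_sum, hy]
  have h1 := hf _ hmem
  rw [map_sub, sub_eq_zero] at h1
  rw [h1, map_sum, sum_apply]
  refine Finset.sum_congr rfl fun j _ => ?_
  exact (DFunLike.congr_fun (hx j) ((e j).comp (toCLM T))).symm

/-- The coefficients `φ j ∘ toDualOp f` are points of `X` by reflexivity; injectivity of `toDualOp`
does the rest. -/
theorem CompactOp.exists_eq_sum_evalDual_of_comp_toDualOp (hX : IsReflexiveSpace X)
    (hmap : HasMetricApproximationProperty X) {n : ℕ}
    {e : Fin n → StrongDual ℝ Y} {φ : Fin n → StrongDual ℝ (StrongDual ℝ Y)}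
    {f : StrongDual ℝ (CompactOp X Y)}
    (hf : ∀ χ, ∑ j, φ j (toDualOp f χ) • e j = toDualOp f χ) :
    ∃ x : Fin n → X, f = ∑ j, evalDual (x j) (e j) := by
  choose x hx using fun j => hX ((φ j).comp (toDualOp f))
  refine ⟨x, toDualOp_injective hX hmap ?_⟩
  ext1 χ
  rw [map_sum, sum_apply, ← hf χ]
  refine Finset.sum_congr rfl fun j _ => ?_
  rw [toDualOp_evalDual]
  congr 1
  exact (DFunLike.congr_fun (hx j) χ).symm

/-- On functionals of the form `∑ j, evalDual (x j) (e j)` with `e` fixed, every element of the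
bidual is given by a compact operator. -/
theorem CompactOp.exists_forall_bidual_eq {n : ℕ} {e : Fin n → StrongDual ℝ Y}
    (he : LinearIndependent ℝ e) (Ψ : StrongDual ℝ (StrongDual ℝ (CompactOp X Y))) :
    ∃ T : CompactOp X Y, ∀ x : Fin n → X,
      Ψ (∑ j, evalDual (x j) (e j)) = (∑ j, evalDual (x j) (e j)) T := by
  obtain ⟨y, hy⟩ := he.exists_biorthogonal
  -- For fixed `e j`, `Ψ` restricts to a functional of `x j` alone.
  refine ⟨∑ j, rankOne (Ψ.comp (evalDual.flip (e j))) (y j), fun x => ?_⟩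
  simp [map_sum, hy]

/-- The dual of the quotient embeds isometrically as the annihilator. A bidual element of the
quotient extends to one of the whole space, which acts on the annihilator as evaluation at a compact
operator. -/
theorem CompactOp.isFactorReflexive_of_annihilator {n : ℕ} {e : Fin n → StrongDual ℝ Y}
    (he : LinearIndependent ℝ e) {Z : Submodule ℝ (CompactOp X Y)}
    (hZ : ∀ f ∈ annihilatorSubspace Z, ∃ x : Fin n → X, f = ∑ j, evalDual (x j) (e j)) :
    IsFactorReflexive Z := by
  intro ψ
  let π : CompactOp X Y →L[ℝ] CompactOp X Y ⧸ Z := Z.mkQ.mkContinuous 1 fun T => by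
    rw [one_mul]; exact Submodule.Quotient.norm_mk_le (S := Z) T
  let Λ : StrongDual ℝ (CompactOp X Y ⧸ Z) →ₗ[ℝ] StrongDual ℝ (CompactOp X Y) :=
    { toFun := fun g => g.comp π
      map_add' := fun g h => by ext; rfl
      map_smul' := fun c g => by ext; rfl }
  have hΛ : ∀ g, ‖g‖ ≤ ‖Λ g‖ := by
    intro g
    refine g.opNorm_le_bound (norm_nonneg _) fun v => ?_
    refine le_of_forall_pos_le_add fun ε hε => ?_
    obtain ⟨T, rfl, hT⟩ := Submodule.Quotient.norm_mk_lt v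
      (ε := ε / (‖Λ g‖ + 1)) (by positivity)
    have h1 : ‖g (Submodule.Quotient.mk T)‖ ≤ ‖Λ g‖ * ‖T‖ := (Λ g).le_opNorm T
    have h2 : ‖Λ g‖ * (ε / (‖Λ g‖ + 1)) ≤ ε := by
      rw [← mul_div_assoc, div_le_iff₀ (by positivity)]
      nlinarith [norm_nonneg (Λ g)]
    have h3 := mul_le_mul_of_nonneg_left hT.le (norm_nonneg (Λ g))
    linarith
  obtain ⟨Ψ, -, hΨ⟩ := exists_dual_comp_eq_of_le_norm Λ (ψ : _ →ₗ[ℝ] ℝ) (norm_nonneg ψ)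
    (fun g => (ψ.le_opNorm g).trans (by gcongr; exact hΛ g))
  obtain ⟨T, hT⟩ := exists_forall_bidual_eq (X := X) he Ψ
  refine ⟨Submodule.Quotient.mk T, ?_⟩
  ext g
  have hg : Λ g ∈ annihilatorSubspace Z := by
    intro z hz
    change g (Submodule.Quotient.mk z) = 0
    rw [(Submodule.Quotient.mk_eq_zero Z).2 hz, map_zero]
  obtain ⟨x, hx⟩ := hZ _ hg
  have h1 : ψ g = Ψ (Λ g) := (hΨ g).symm
  rw [h1, hx, hT, ← hx]
  rfl

theorem CompactOp.isProximinal_of_annihilator [CompleteSpace Y] (hX : IsReflexiveSpace X) {n : ℕ}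
    {e : Fin n → StrongDual ℝ Y} (he : LinearIndependent ℝ e)
    {P : StrongDual ℝ (CompactOp X Y) →ₗ[ℝ] StrongDual ℝ (CompactOp X Y)}
    (hP : ∀ f, ‖P f‖ + ‖f - P f‖ ≤ ‖f‖)
    (hPM : ∀ f, P f ∈ annihilatorSubspace (leftKer (X := X) e))
    (hPid : ∀ f ∈ annihilatorSubspace (leftKer (X := X) e), P f = f)
    {Z : Submodule ℝ (CompactOp X Y)} (hZc : IsClosed (Z : Set (CompactOp X Y)))
    (hZ : ∀ f ∈ annihilatorSubspace Z, ∃ x : Fin n → X, f = ∑ j, evalDual (x j) (e j)) :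
    IsProximinal Z := by
  intro T
  set d := Metric.infDist T (Z : Set (CompactOp X Y)) with hd
  have hd0 : 0 ≤ d := Metric.infDist_nonneg
  -- Evaluation at `T` has norm at most `d` on the annihilator only; the Hahn–Banach extension `Ψ`
  -- keeps this bound on the larger annihilator of `leftKer e`.
  have hfT : ∀ f ∈ annihilatorSubspace Z, |f T| ≤ d * ‖f‖ := by
    intro f hf
    rcases (norm_nonneg f).eq_or_lt with h0 | h0
    · rw [norm_eq_zero.1 h0.symm]
      simp
    rw [← div_le_iff₀ h0, hd, Metric.le_infDist ⟨0, Z.zero_mem⟩]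
    intro z hz
    rw [div_le_iff₀ h0, mul_comm, dist_eq_norm]
    have h1 := f.le_opNorm (T - z)
    rwa [map_sub, hf z hz, sub_zero] at h1
  obtain ⟨Ψ, hΨn, hΨ⟩ := exists_dual_comp_eq_of_le_norm (annihilatorSubmodule Z).subtype
    ((ContinuousLinearMap.apply ℝ ℝ T : StrongDual ℝ (CompactOp X Y) →ₗ[ℝ] ℝ).comp
      (annihilatorSubmodule Z).subtype) hd0 (fun f : annihilatorSubmodule Z => hfT f f.2)
  obtain ⟨T', hT'⟩ := exists_forall_bidual_eq (X := X) he Ψ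
  have hT'd : ∀ f ∈ annihilatorSubspace (leftKer (X := X) e), f T' ≤ d * ‖f‖ := by
    intro f hf
    obtain ⟨x, rfl⟩ := exists_eq_sum_evalDual_of_mem_annihilator hX he hf
    rw [← hT']
    exact (le_abs_self _).trans (Ψ.le_of_opNorm_le hΨn _)
  obtain ⟨m, hm, hmd⟩ := exists_mem_norm_sub_le_of_lProjection (isClosed_leftKer e) P hPM hPid hP
    hd0 hT'd
  have hmem : T - T' + m ∈ Z := by
    refine mem_of_forall_annihilator hZc fun f hf => ?_
    obtain ⟨x, hx⟩ := hZ f hf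
    have h1 : f m = 0 := by rw [hx]; exact sum_evalDual_mem_annihilator e x m hm
    have h2 : Ψ f = f T := hΨ ⟨f, hf⟩
    have h3 : Ψ f = f T' := by rw [hx]; exact hT' x
    rw [map_add, map_sub, h1, ← h2, ← h3, sub_self, zero_add]
  refine ⟨_, hmem, le_antisymm ?_ ?_⟩
  · rw [← dist_eq_norm]
    exact Metric.infDist_le_dist_of_mem hmem
  · have : T - (T - T' + m) = T' - m := by abel
    rwa [this]

end FactorReflexive

/-! ### Coordinate projections of an `ℓ¹`-sum -/

section LOneSum

variable {I : Type*} {F : I → Type*} [∀ i, NormedAddCommGroup (F i)] [∀ i, NormedSpace ℝ (F i)]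

/-- The coordinate projections of an `ℓ¹`-sum of finite-dimensional spaces, transported along an
isometric isomorphism. -/
theorem exists_coordinate_lProjection [∀ i, FiniteDimensional ℝ (F i)] {V : Type*}
    [NormedAddCommGroup V] [NormedSpace ℝ V] (Φ : V ≃ₗᵢ[ℝ] lp F 1) [DecidableEq I]
    (J : Finset I) :
    ∃ q : V →L[ℝ] V, FiniteDimensional ℝ (LinearMap.range (q : V →ₗ[ℝ] V)) ∧
      (∀ v, ‖q v‖ + ‖v - q v‖ ≤ ‖v‖) ∧ ∀ v i, Φ (q v) i = if i ∈ J then Φ v i else 0 := by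
  let A : I → V →L[ℝ] V := fun i =>
    ((Φ.symm.toContinuousLinearEquiv : lp F 1 →L[ℝ] V).comp
      (lp.singleContinuousLinearMap ℝ F 1 i)).comp
      ((lp.evalCLM ℝ F 1 i).comp (Φ.toContinuousLinearEquiv : V →L[ℝ] lp F 1))
  have hA : ∀ i v, Φ (A i v) = lp.single 1 i (Φ v i) := fun i v => Φ.apply_symm_apply _
  have hq : ∀ v, Φ ((∑ i ∈ J, A i) v) = ∑ i ∈ J, lp.single 1 i (Φ v i) := by
    intro v
    rw [sum_apply, map_sum]
    exact Finset.sum_congr rfl fun i _ => hA i v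
  refine ⟨∑ i ∈ J, A i, ?_, fun v => ?_, fun v i => ?_⟩
  · have hfin : ∀ i, FiniteDimensional ℝ (LinearMap.range (A i : V →ₗ[ℝ] V)) := by
      intro i
      refine Submodule.finiteDimensional_of_le (S₂ := LinearMap.range
        (((Φ.symm.toContinuousLinearEquiv : lp F 1 →L[ℝ] V).comp
          (lp.singleContinuousLinearMap ℝ F 1 i) : F i →L[ℝ] V) : F i →ₗ[ℝ] V)) ?_
      rintro _ ⟨v, rfl⟩
      exact ⟨Φ v i, rfl⟩
    refine Submodule.finiteDimensional_of_le
      (S₂ := J.sup fun i => LinearMap.range (A i : V →ₗ[ℝ] V)) ?_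
    rintro _ ⟨v, rfl⟩
    change (∑ i ∈ J, A i) v ∈ _
    rw [sum_apply]
    exact Submodule.sum_mem _ fun i hi =>
      Finset.le_sup (f := fun i => LinearMap.range (A i : V →ₗ[ℝ] V)) hi ⟨v, rfl⟩
  · have h1 := lp.norm_compl_sum_single (p := 1) (by simp) (Φ v) J
    have h2 := lp.norm_sum_single (p := 1) (by simp) (fun i => Φ v i) J
    simp only [ENNReal.toReal_one, Real.rpow_one] at h1 h2
    rw [← Φ.norm_map, ← Φ.norm_map (v - _), map_sub, hq, h1, h2, Φ.norm_map]
    linarith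
  · rw [hq, lp.coeFn_sum, Finset.sum_apply]
    split_ifs with hi
    · rw [Finset.sum_eq_single i]
      · simp
      · intro k _ hk
        simp [lp.single_apply, hk.symm]
      · exact fun h => absurd hi h
    · refine Finset.sum_eq_zero fun k hk => ?_
      have : i ≠ k := fun h => hi (h ▸ hk)
      simp [lp.single_apply, this]

end LOneSum

/-! ### Finiteness of supports -/

section LProjections

variable {E I : Type*} [NormedAddCommGroup E] [NormedSpace ℝ E] {P : I → E →ₗ[ℝ] E}

/-- Removing `P k f` leaves the other components unchanged and lowers the norm by at least `‖P k
f‖`. -/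
theorem sum_norm_le_of_lProjections (hP : ∀ i f, ‖P i f‖ + ‖f - P i f‖ ≤ ‖f‖)
    (horth : ∀ i j, i ≠ j → ∀ f, P i (P j f) = 0) (J : Finset I) (f : E) :
    ∑ i ∈ J, ‖P i f‖ ≤ ‖f‖ := by
  classical
  induction J using Finset.induction_on generalizing f with
  | empty => simp
  | insert k J hk ih =>
    rw [Finset.sum_insert hk]
    have h1 : ∑ i ∈ J, ‖P i f‖ = ∑ i ∈ J, ‖P i (f - P k f)‖ := by
      refine Finset.sum_congr rfl fun i hi => ?_
      rw [map_sub, horth i k (fun h => hk (h ▸ hi)), sub_zero]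
    linarith [ih (f - P k f), hP k f]

/-- Non-zero components have norm at least some `t₀ > 0`, so more than `‖f‖ / t₀` of them would
exceed the total norm. -/
theorem IsSSDPoint.finite_support_of_lProjections (hP : ∀ i f, ‖P i f‖ + ‖f - P i f‖ ≤ ‖f‖)
    (hidem : ∀ i f, P i (P i f) = P i f) (horth : ∀ i j, i ≠ j → ∀ f, P i (P j f) = 0)
    {f : E} (hf : IsSSDPoint f) : {i | P i f ≠ 0}.Finite := by
  by_contra hinf
  obtain ⟨t₀, ht₀, ht⟩ := hf.exists_le_norm_of_lProjection
  obtain ⟨n, hn⟩ := exists_nat_gt (‖f‖ / t₀)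
  obtain ⟨J, hJ, hJn⟩ := Set.Infinite.exists_subset_card_eq hinf n
  have h1 := sum_norm_le_of_lProjections hP horth J f
  have h2 : ∑ _i ∈ J, t₀ ≤ ∑ i ∈ J, ‖P i f‖ :=
    Finset.sum_le_sum fun i hi => ht (P i) (hP i) (hidem i f) (hJ hi)
  rw [Finset.sum_const, hJn, nsmul_eq_mul] at h2
  rw [div_lt_iff₀ ht₀] at hn
  linarith

/-- If every element of a Banach space is supported on finitely many coordinates, then so is the
space. -/
theorem finite_support_of_forall_finite_support {G : Type*} [NormedAddCommGroup G]
    [NormedSpace ℝ G] [CompleteSpace G] {H : I → Type*} [∀ i, NormedAddCommGroup (H i)]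
    [∀ i, NormedSpace ℝ (H i)] (A : ∀ i, G →L[ℝ] H i) (hA : ∀ g, {i | A i g ≠ 0}.Finite) :
    {i | ∃ g, A i g ≠ 0}.Finite := by
  by_contra hinf
  let ι := Set.Infinite.natEmbedding _ hinf
  -- `ι` enumerates infinitely many active coordinates. The closed subspaces `W n` cover `G`, so by
  -- Baire one of them is `G`, and then `ι n` is not active.
  let W : ℕ → Submodule ℝ G := fun n => ⨅ m : Set.Ici n, LinearMap.ker (A (ι m)).toLinearMap
  have hWmem : ∀ n g, g ∈ W n ↔ ∀ m ≥ n, A (ι m) g = 0 := by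
    intro n g
    simp [W, Submodule.mem_iInf]
  have hWc : ∀ n, IsClosed (W n : Set G) := by
    intro n
    have : (W n : Set G) = ⋂ m ≥ n, {g | A (ι m) g = 0} := by
      ext g
      simp only [SetLike.mem_coe, hWmem, mem_iInter]
      rfl
    rw [this]
    exact isClosed_biInter fun m _ => isClosed_eq (A (ι m)).continuous continuous_const
  have hWU : ⋃ n, (W n : Set G) = univ := by
    refine eq_univ_of_forall fun g => ?_
    have hfin : {m : ℕ | A (ι m) g ≠ 0}.Finite :=
      Set.Finite.preimage (f := fun m => (ι m : I))
        (Subtype.val_injective.comp ι.injective).injOn (hA g)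
    obtain ⟨n, hn⟩ := hfin.bddAbove
    refine mem_iUnion.2 ⟨n + 1, (hWmem _ _).2 fun m hm => ?_⟩
    by_contra hne
    have := hn hne
    omega
  obtain ⟨n, hn⟩ := nonempty_interior_of_iUnion_of_closed hWc hWU
  have htop := Submodule.eq_top_of_nonempty_interior' _ hn
  obtain ⟨g, hg⟩ := (ι n).2
  exact hg ((hWmem n g).1 (htop ▸ Submodule.mem_top) n le_rfl)

end LProjections

/-! ### The main theorem -/

theorem theorem8 {X Y I : Type*} {F : I → Type*}
    [NormedAddCommGroup X] [NormedSpace ℝ X] [CompleteSpace X]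
    [NormedAddCommGroup Y] [NormedSpace ℝ Y] [CompleteSpace Y]
    [Infinite I]
    [∀ i, NormedAddCommGroup (F i)] [∀ i, NormedSpace ℝ (F i)]
    [∀ i, FiniteDimensional ℝ (F i)]
    (hXrefl : IsReflexiveSpace X) (hXmap : HasMetricApproximationProperty X)
    (hY : Nonempty (StrongDual ℝ Y ≃ₗᵢ[ℝ] lp F 1))
    (Z : Submodule ℝ (CompactOp X Y)) (hZclosed : IsClosed (Z : Set (CompactOp X Y)))
    (hZ : ∀ f ∈ annihilatorSubspace Z, f ≠ 0 → IsSSDPoint f) :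
    IsFactorReflexive Z ∧ IsProximinal Z := by
  classical
  obtain ⟨Φ⟩ := hY
  choose q hqfin hqn hq using exists_coordinate_lProjection Φ
  choose P hPB hPn using fun J : Finset I =>
    CompactOp.exists_lProjection hXrefl hXmap (q J) (hqfin J) (hqn J)
  have hinj := CompactOp.toDualOp_injective (Y := Y) hXrefl hXmap
  have hext : ∀ v w : StrongDual ℝ Y, (∀ i, Φ v i = Φ w i) → v = w := fun v w h =>
    Φ.injective (lp.ext (funext h))
  -- Identities between the `P J` are read off coordinatewise from the `q J` through the injective
  -- `toDualOp`.
  have hidem : ∀ J f, P J (P J f) = P J f := by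
    intro J f
    apply hinj
    rw [hPB, hPB]
    ext1 χ
    refine hext _ _ fun i => ?_
    simp only [ContinuousLinearMap.comp_apply, hq]
    split_ifs <;> rfl
  have horth : ∀ i j : I, i ≠ j → ∀ f, P {i} (P {j} f) = 0 := by
    intro i j hij f
    apply hinj
    rw [hPB, hPB, map_zero]
    ext1 χ
    refine hext _ _ fun k => ?_
    simp only [ContinuousLinearMap.comp_apply, hq, Finset.mem_singleton, zero_apply, map_zero]
    split_ifs with h1 h2
    · exact absurd (h1.symm.trans h2) hij
    all_goals rfl
  let N := annihilatorSubmodule Z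
  have : CompleteSpace N := (isClosed_annihilatorSubmodule Z).completeSpace_coe
  let A : I → N →L[ℝ] StrongDual ℝ (CompactOp X Y) := fun i =>
    ((P {i}).mkContinuous 1 fun f => by
      linarith [hPn {i} f, norm_nonneg (f - P {i} f)]).comp N.subtypeL
  have hfin : {i | ∃ g, A i g ≠ 0}.Finite := by
    refine finite_support_of_forall_finite_support
      (G := N) (H := fun _ => StrongDual ℝ (CompactOp X Y)) A fun g => ?_
    by_cases hg : (g : StrongDual ℝ (CompactOp X Y)) = 0
    · refine Set.Finite.subset Set.finite_empty fun i hi => hi ?_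
      change P {i} (g : StrongDual ℝ (CompactOp X Y)) = 0
      rw [hg, map_zero]
    · exact (hZ g g.2 hg).finite_support_of_lProjections (P := fun i => P {i})
        (fun i => hPn {i}) (fun i => hidem {i}) horth
  let J : Finset I := hfin.toFinset
  -- Outside `J` every `P {i} f` vanishes, so `toDualOp f` takes values in the range of `q J`.
  have hZJ : ∀ f ∈ annihilatorSubspace Z, ∀ χ, q J (CompactOp.toDualOp f χ) =
      CompactOp.toDualOp f χ := by
    intro f hf χ
    refine hext _ _ fun i => ?_
    rw [hq]
    split_ifs with hi
    · rfl
    · have h1 : P {i} f = 0 := by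
        by_contra hne
        exact hi (hfin.mem_toFinset.2 ⟨⟨f, hf⟩, hne⟩)
      have h2 := hPB {i} f
      rw [h1, map_zero] at h2
      have h3 := hq {i} (CompactOp.toDualOp f χ) i
      rw [show q {i} (CompactOp.toDualOp f χ) = 0 from (DFunLike.congr_fun h2 χ).symm] at h3
      simpa using h3
  obtain ⟨n, e, φ, he, heq, hqe⟩ := (q J).exists_eq_sum_of_finiteDimensional_range (hqfin J)
  have hqid : ∀ j, q J (e j) = e j := by
    intro j
    obtain ⟨v, hv⟩ := heq j
    rw [← hv]
    refine hext _ _ fun i => ?_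
    change Φ (q J (q J v)) i = Φ (q J v) i
    simp only [hq]
    split_ifs <;> rfl
  have hZe : ∀ f ∈ annihilatorSubspace Z,
      ∃ x : Fin n → X, f = ∑ j, CompactOp.evalDual (x j) (e j) := by
    intro f hf
    refine CompactOp.exists_eq_sum_evalDual_of_comp_toDualOp hXrefl hXmap (φ := φ) fun χ => ?_
    rw [← hqe]
    exact hZJ f hf χ
  -- What remains is that `P J` projects onto the annihilator of `leftKer e`.
  refine ⟨CompactOp.isFactorReflexive_of_annihilator he hZe,
    CompactOp.isProximinal_of_annihilator hXrefl he (hPn J) (fun f => ?_) (fun f hf => ?_)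
      hZclosed hZe⟩
  · obtain ⟨x, hx⟩ := CompactOp.exists_eq_sum_evalDual_of_comp_toDualOp hXrefl hXmap
      (f := P J f) (e := e) (φ := φ) fun χ => by
        rw [← hqe, ← ContinuousLinearMap.comp_apply, ← hPB, hidem]
    rw [hx]
    exact CompactOp.sum_evalDual_mem_annihilator e x
  · obtain ⟨x, rfl⟩ := CompactOp.exists_eq_sum_evalDual_of_mem_annihilator hXrefl he hf
    apply hinj
    rw [hPB]
    ext1 χ
    simp only [map_sum, ContinuousLinearMap.comp_apply, sum_apply, CompactOp.toDualOp_evalDual,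
      map_smul, hqid]
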